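/- Let $E$ be a real locally convex space with its Borel $\sigma$-algebra, and let $H\subset E$ be a Hilbert subspace, i.e. a vector subspace with a Hilbert space structure whose norm topology is finer than the topology induced from $E$. A map on $E$ is *$H$-smooth* if it is infinitely (Gâteaux) differentiable along $H$ and the map and all its derivatives are continuous on $E$, the spaces of multilinear maps on $H$ carrying the topology of uniform convergence on compact sets. Let $C$ be a complex vector space of complex $H$-smooth functions on $E$, bounded together with all their derivatives along $H$, which is norm-defining: for every complex Borel measure $\mu$ on $E$, its total variation norm equals $\sup\{|\int u\,d\mu| : u\in C,\ \sup|u|\le 1\}$. Let $\tau_C$ be the weak topology on the space of complex measures given by the pairing with $C$, and let $\nu$ be a complex Borel measure on $E$ with total variation measure $|\nu|$. For a vector field $v:E\to E$ put $S(t)x:=x-t\,v(x)$ and suppose these maps are Borel for small $|t|$. The *$\tau_C$-logarithmic derivative of $\nu$ along $v$* is the density $\gamma\in L^1(|\nu|)$, if it exists, with respect to $\nu$ of the derivative at $t=0$ of $t\mapsto S(t)_*\nu$ in the topology $\tau_C$. The *$C$-logarithmic derivative of $\nu$ along $v$* is the density $\gamma\in L^1(|\nu|)$, if it exists, with respect to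 $\nu$ of a complex measure $\nu'_v$ such that $\int \varphi'(x)v(x)\,\nu(dx)=-\int\varphi\,d\nu'_v$ for all $\varphi\in C$. Suppose that $\nu$ has a $\tau_C$-logarithmic derivative $\beta^\nu$ over $H$: for every $x\in E$ the map $k\mapsto\beta^\nu(k,x)$ is real-linear from $H$ to $\mathbb C$, and for every $k\in H$ the function $\beta^\nu(k,\cdot)$ is the $\tau_C$-logarithmic derivative of $\nu$ along the constant field $k$. Let $h:E\to H$ be strongly measurable and differentiable along $H$, with derivative $h'(x)\in L(H,H)$, i.e. for all $x\in E$ and $k\in H$ the limit $h'(x)k=\lim_{t\to0}t^{-1}(h(x+tk)-h(x))$ exists in $H$ and defines a bounded linear operator. Assume: 1. for all $\varphi\in C$ and $k\in H$, the function $x\mapsto \varphi(x)\,\langle k,h(x)\rangle_H$ belongs to $C$; 2. $\|h(\cdot)\|_H\in L^1(|\nu|)$; 3. there is $N:E\to\mathbb R$ with $N\|h\|_H\in L^1(|\nu|)$ such that for $|\nu|$-almost every $x$, $|\beta^\nu(k,x)|\le N(x)\|k\|_H$ for all $k$ in the closed linear span of $h(E)$ in $H$; 4. for $|\nu|$-almost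 every $x$ the operator $h'(x)$ is trace class, with trace norm bounded by $M(x)$ for some $M\in L^1(|\nu|)$. Then the logarithmic derivative $\beta^\nu_h$ of $\nu$ along $h$ exists, both as a $C$-logarithmic derivative and as a $\tau_C$-logarithmic derivative, is unique up to $|\nu|$-null sets, and $$\beta_h^\nu(x)=\beta^\nu(h(x),x)+\operatorname{tr} h'(x)\qquad\text{for } |\nu|\text{-almost every } x .$$ -/

import Mathlib

open MeasureTheory Topology Filter
open scoped ENNReal

/-! ### Maps that are smooth along a Hilbert subspace

A Hilbert subspace of a locally convex space `E` is given by a Hilbert space `H` together with an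
injective continuous linear map `ι : H →L[ℝ] E`. -/

/-- `D n` is the `n`-th derivative of `f : E → G` along `ι : H → E`, for every `n`: each `D (n + 1)`
is the Gâteaux derivative along `H` of `D n`, and every `D n` is continuous on `E`, where the space
of `n`-linear maps carries the topology of uniform convergence on compact subsets of `H`. -/
structure IsHDerivSeq {E H G : Type*} [AddCommGroup E] [Module ℝ E] [TopologicalSpace E]
    [NormedAddCommGroup H] [InnerProductSpace ℝ H] [NormedAddCommGroup G] [NormedSpace ℝ G]
    (ι : H →L[ℝ] E) (f : E → G)
    (D : (n : ℕ) → E → ContinuousMultilinearMap ℝ (fun _ : Fin n => H) G) : Prop where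
  zero : ∀ x, D 0 x Fin.elim0 = f x
  deriv : ∀ (n : ℕ) (x : E) (k : H) (K : Set H), IsCompact K →
    TendstoUniformlyOn (fun (t : ℝ) (v : Fin n → H) => t⁻¹ • (D n (x + t • ι k) v - D n x v))
      (fun v => D (n + 1) x (Fin.cons k v)) (𝓝[≠] 0) (Set.univ.pi fun _ => K)
  cont : ∀ (n : ℕ) (x : E) (K : Set H), IsCompact K →
    TendstoUniformlyOn (fun (y : E) (v : Fin n → H) => D n y v) (fun v => D n x v)
      (𝓝 x) (Set.univ.pi fun _ => K)

/-- `f` is `H`-smooth and bounded together with all its derivatives along `H`. -/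
def IsBoundedHSmooth {E H G : Type*} [AddCommGroup E] [Module ℝ E] [TopologicalSpace E]
    [NormedAddCommGroup H] [InnerProductSpace ℝ H] [NormedAddCommGroup G] [NormedSpace ℝ G]
    (ι : H →L[ℝ] E) (f : E → G) : Prop :=
  ∃ D : (n : ℕ) → E → ContinuousMultilinearMap ℝ (fun _ : Fin n => H) G,
    IsHDerivSeq ι f D ∧ ∀ n, ∃ M : ℝ, ∀ x, ‖D n x‖ ≤ M

/-! ### Complex measures -/

/-- The integral `∫ u dμ` of a complex function against a complex measure. -/
noncomputable def cintegral {E : Type*} [MeasurableSpace E] (μ : ComplexMeasure E) (u : E → ℂ) :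
    ℂ :=
  VectorMeasure.integral μ u (ContinuousLinearMap.mul ℝ ℂ)

/-- The space `C` of functions determines the total variation norm of complex measures. -/
def IsNormDefining {E : Type*} [MeasurableSpace E] (C : Submodule ℂ (E → ℂ)) : Prop :=
  ∀ μ : ComplexMeasure E,
    IsLUB {r : ℝ | ∃ u ∈ C, (∀ x, ‖u x‖ ≤ 1) ∧ r = ‖cintegral μ u‖}
      (VectorMeasure.variation μ Set.univ).toReal

/-- `C` is a norm-defining vector space of `H`-smooth functions bounded together with all their
derivatives along `H`. -/
structure IsTestSpace {E H : Type*} [AddCommGroup E] [Module ℝ E] [TopologicalSpace E]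
    [MeasurableSpace E] [NormedAddCommGroup H] [InnerProductSpace ℝ H]
    (ι : H →L[ℝ] E) (C : Submodule ℂ (E → ℂ)) : Prop where
  smooth : ∀ φ ∈ C, IsBoundedHSmooth ι φ
  normDefining : IsNormDefining C

/-- `ν'` is absolutely continuous with respect to `ν` with density `γ`, that is `ν' = γ ν`. -/
def IsDensity {E : Type*} [MeasurableSpace E] (ν ν' : ComplexMeasure E) (γ : E → ℂ) : Prop :=
  VectorMeasure.Integrable ν γ ∧
    ν' = VectorMeasure.withDensity ν γ (ContinuousLinearMap.mul ℝ ℂ)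

/-! ### Logarithmic derivatives -/

/-- `γ` is the `τ_C`-logarithmic derivative of `ν` along the family `S t` (`t` near `0`) of
measurable self-maps of `E`: the map `t ↦ (S t)_* ν` is differentiable at `0` for the weak topology
`τ_C` given by the pairing of measures with functions in `C`, and its derivative has density `γ`
with respect to `ν`. -/
def IsTauLogDeriv {E : Type*} [MeasurableSpace E] (C : Submodule ℂ (E → ℂ))
    (ν : ComplexMeasure E) (S : ℝ → E → E) (γ : E → ℂ) : Prop :=
  S 0 = id ∧ (∀ᶠ t in 𝓝 (0 : ℝ), Measurable (S t)) ∧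
    ∃ ν' : ComplexMeasure E,
      (∀ φ ∈ C, HasDerivAt (fun t : ℝ => cintegral (VectorMeasure.map ν (S t)) φ)
        (cintegral ν' φ) 0) ∧
      IsDensity ν ν' γ

/-- `γ` is the `τ_C`-logarithmic derivative of `ν` along the vector field `v`. -/
def IsTauLogDerivAlong {E : Type*} [AddCommGroup E] [Module ℝ E] [MeasurableSpace E]
    (C : Submodule ℂ (E → ℂ)) (ν : ComplexMeasure E) (v : E → E) (γ : E → ℂ) : Prop :=
  IsTauLogDeriv C ν (fun t x => x - t • v x) γ

/-- `β` is the `τ_C`-logarithmic derivative of `ν` over the Hilbert subspace `H`: it is linear in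
`k ∈ H`, and `x ↦ β x k` is the `τ_C`-logarithmic derivative of `ν` along the constant vector field
`k`, for every `k ∈ H`. -/
def IsTauLogDerivOver {E H : Type*} [AddCommGroup E] [Module ℝ E] [TopologicalSpace E]
    [MeasurableSpace E] [NormedAddCommGroup H] [InnerProductSpace ℝ H] (ι : H →L[ℝ] E)
    (C : Submodule ℂ (E → ℂ)) (ν : ComplexMeasure E) (β : E → H →ₗ[ℝ] ℂ) : Prop :=
  ∀ k : H, IsTauLogDerivAlong C ν (fun _ => ι k) (fun x => β x k)

/-- `γ` is the `C`-logarithmic derivative of `ν` along the vector field `v`: there is a complex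
measure `ν'` with `∫ φ'(x) v(x) ν(dx) = - ∫ φ(x) ν'(dx)` for all `φ ∈ C`, and `ν'` has density
`γ` with respect to `ν`. -/
def IsCLogDerivAlong {E : Type*} [AddCommGroup E] [Module ℝ E] [MeasurableSpace E]
    (C : Submodule ℂ (E → ℂ)) (ν : ComplexMeasure E) (v : E → E) (γ : E → ℂ) : Prop :=
  ∃ ν' : ComplexMeasure E,
    (∀ φ ∈ C, (∀ x, LineDifferentiableAt ℝ φ x (v x)) ∧
      VectorMeasure.Integrable ν (fun x => lineDeriv ℝ φ x (v x)) ∧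
      cintegral ν (fun x => lineDeriv ℝ φ x (v x)) = -cintegral ν' φ) ∧
    IsDensity ν ν' γ

/-! ### Trace class operators -/

/-- The trace norm of a bounded operator on a Hilbert space, in its form as the nuclear norm: the
infimum of `∑ ‖aₙ‖ ‖bₙ‖` over all representations `T = ∑ ⟨aₙ, ·⟩ bₙ`. It is finite exactly when
`T` is trace class. -/
noncomputable def traceNorm {H : Type*} [NormedAddCommGroup H] [InnerProductSpace ℝ H]
    (T : H →L[ℝ] H) : ℝ≥0∞ :=
  ⨅ (a : ℕ → H) (b : ℕ → H) (_ : ∀ x, HasSum (fun n => inner ℝ (a n) x • b n) (T x)),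
    ∑' n, ‖a n‖ₑ * ‖b n‖ₑ

/-- The trace `∑ᵢ ⟨eᵢ, T eᵢ⟩` of a trace class operator, over a Hilbert basis of `H` (the value
does not depend on the basis when `T` is trace class). -/
noncomputable def hilbertTrace {H : Type*} [NormedAddCommGroup H] [InnerProductSpace ℝ H]
    [CompleteSpace H] (T : H →L[ℝ] H) : ℝ :=
  ∑' e : (exists_hilbertBasis ℝ H).choose, inner ℝ (e : H) (T e)

/-! ### Integration against complex measures, densities, and uniqueness of measures. -/

section ComplexMeasure

variable {E : Type*} [MeasurableSpace E]

/-! For `φ ∈ C` and `k ∈ H` the function `φ ⟨k, h⟩` is again in `C`, so it may be tested against the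
logarithmic derivative along the constant field `k`. The product rule then gives `∫ (φ' k ⟨k, h⟩ + φ
⟨k, h' k⟩ + φ ⟨k, h⟩ β k) dν = 0` (`cintegral_lineDeriv_component`). Let `k` run through a Hilbert
basis of the closed span `K` of `h(E)` and sum over finite sets: the three terms become `φ'` at a
partial expansion of `h`, `φ` times a partial trace of `h'`, and `φ` times `β` at the partial
expansion. They are dominated by multiples of `‖h‖`, `|M|` and `|N| ‖h‖`, and the limit is `∫ φ' h
dν = -∫ φ (β h + tr h') dν` (`cintegral_lineDeriv_vectorField`).

Working in `K` rather than `H` matters. `K` is separable because `h` is strongly measurable, so the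
basis is countable; `β` is controlled only on `K`; and `h' x` maps into `K`, so no trace is lost
(`hasSum_hilbertTrace`).

The two notions of derivative agree because `t ↦ ∫ φ (x - t h x) dν` has derivative `-∫ φ' h dν` at
`0` (`hasDerivAt_cintegral_map`). Uniqueness holds because a norm-defining `C` separates measures
and a measure determines its density up to null sets. -/

instance ComplexMeasure.isFiniteMeasure_variation (μ : ComplexMeasure E) :
    IsFiniteMeasure (VectorMeasure.variation μ) := by
  refine isFiniteMeasure_of_le
    ((ComplexMeasure.re μ).totalVariation + (ComplexMeasure.im μ).totalVariation) ?_
  refine VectorMeasure.variation_le_of_forall_enorm_le fun s _ => ?_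
  calc ‖μ s‖ₑ = ‖((μ s).re : ℂ) + (μ s).im * Complex.I‖ₑ := by rw [Complex.re_add_im]
    _ ≤ ‖((μ s).re : ℂ)‖ₑ + ‖((μ s).im : ℂ) * Complex.I‖ₑ := enorm_add_le _ _
    _ = ‖ComplexMeasure.re μ s‖ₑ + ‖ComplexMeasure.im μ s‖ₑ := by
        rw [enorm_mul]
        simp only [enorm_eq_nnnorm, Complex.nnnorm_I, Complex.nnnorm_real, ENNReal.coe_one, mul_one]
        rfl
    _ ≤ _ := by
        rw [Measure.add_apply]
        exact add_le_add (SignedMeasure.enorm_le_totalVariation _ _)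
          (SignedMeasure.enorm_le_totalVariation _ _)

lemma integrable_variation_of_bound {μ : ComplexMeasure E} {φ : E → ℂ} (hφ : Measurable φ)
    {A : ℝ} (hA : ∀ x, ‖φ x‖ ≤ A) : VectorMeasure.Integrable μ φ :=
  MeasureTheory.Integrable.of_bound hφ.aestronglyMeasurable A (Eventually.of_forall hA)

/-- The integral is built from a real bilinear pairing; complex homogeneity has to come from
associativity and commutativity of the product in `ℂ`. -/
lemma cintegral_const_mul (μ : ComplexMeasure E) (c : ℂ) (f : E → ℂ) :
    cintegral μ (fun x => c * f x) = c * cintegral μ f := by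
  refine setToFun_smul (𝕜 := ℂ) (dominatedFinMeasAdditive_cbmApplyMeasure μ _) ?_ c f
  intro c s x
  change (c * x) * μ s = c * (x * μ s)
  ring

lemma cintegral_add (μ : ComplexMeasure E) {f g : E → ℂ} (hf : VectorMeasure.Integrable μ f)
    (hg : VectorMeasure.Integrable μ g) :
    cintegral μ (fun x => f x + g x) = cintegral μ f + cintegral μ g :=
  VectorMeasure.integral_fun_add hf hg

lemma cintegral_neg (μ : ComplexMeasure E) (f : E → ℂ) :
    cintegral μ (fun x => -f x) = -cintegral μ f :=
  VectorMeasure.integral_fun_neg _ _ _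

/-- True on indicators by definition of the density, hence on simple functions; uniformly bounded
simple approximations and dominated convergence on both sides give the rest. -/
lemma cintegral_withDensity (ν : ComplexMeasure E) {γ φ : E → ℂ}
    (hγ : VectorMeasure.Integrable ν γ) (hφ : Measurable φ) {A : ℝ} (hA : ∀ x, ‖φ x‖ ≤ A) :
    cintegral (VectorMeasure.withDensity ν γ (ContinuousLinearMap.mul ℝ ℂ)) φ =
      cintegral ν (fun x => φ x * γ x) := by
  set ν' := VectorMeasure.withDensity ν γ (ContinuousLinearMap.mul ℝ ℂ)
  have hsimple : ∀ f : SimpleFunc E ℂ, cintegral ν' f = cintegral ν (fun x => f x * γ x) := by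
    intro f
    have hint : ∀ (f : SimpleFunc E ℂ) (μ : ComplexMeasure E), VectorMeasure.Integrable μ f :=
      fun f μ => SimpleFunc.integrable_of_isFiniteMeasure f
    have hmul : ∀ f : SimpleFunc E ℂ, VectorMeasure.Integrable ν (fun x => f x * γ x) := by
      intro f
      obtain ⟨c, hc⟩ := f.exists_forall_norm_le
      exact MeasureTheory.Integrable.bdd_mul hγ f.measurable.aestronglyMeasurable
        (Eventually.of_forall hc)
    induction f using SimpleFunc.induction with
    | @const c s hs =>
      have h1 : (⇑((SimpleFunc.const E c).piecewise s hs (SimpleFunc.const E 0)) : E → ℂ) =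
          fun x => c * s.indicator (fun _ => (1 : ℂ)) x := by
        ext x; by_cases hx : x ∈ s <;> simp [hx]
      rw [h1]
      simp_rw [mul_assoc]
      rw [cintegral_const_mul, cintegral_const_mul]
      congr 1
      have h2 : (fun x => s.indicator (fun _ => (1 : ℂ)) x * γ x) = s.indicator γ := by
        ext x; by_cases hx : x ∈ s <;> simp [hx]
      rw [h2]
      unfold cintegral
      rw [VectorMeasure.integral_indicator_const _ hs, VectorMeasure.integral_indicator hs,
        VectorMeasure.withDensity_apply hγ]
      simp
    | @add f g hd hf hg =>
      simp only [SimpleFunc.coe_add, Pi.add_apply, add_mul]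
      change cintegral ν' (fun x => f x + g x) = _
      rw [cintegral_add _ (hint _ _) (hint _ _), cintegral_add _ (hmul _) (hmul _), hf, hg]
  have hs := hφ.stronglyMeasurable
  have hA0 : ∀ n x, ‖hs.approxBounded A n x‖ ≤ A ⊔ 0 := by
    intro n x
    exact (StronglyMeasurable.norm_approxBounded_le hs ((norm_nonneg _).trans (hA x)) n x).trans
      le_sup_left
  have hlim : ∀ x, Tendsto (fun n => hs.approxBounded A n x) atTop (𝓝 (φ x)) := fun x =>
    hs.tendsto_approxBounded_of_norm_le (hA x)
  have t1 : Tendsto (fun n => cintegral ν' (hs.approxBounded A n)) atTop (𝓝 (cintegral ν' φ)) :=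
    VectorMeasure.tendsto_integral_of_dominated_convergence (fun _ => A ⊔ 0)
      (fun n => (SimpleFunc.measurable _).aestronglyMeasurable) (integrable_const _)
      (fun n => Eventually.of_forall (hA0 n)) (Eventually.of_forall hlim)
  have t2 : Tendsto (fun n => cintegral ν (fun x => hs.approxBounded A n x * γ x)) atTop
      (𝓝 (cintegral ν (fun x => φ x * γ x))) := by
    refine VectorMeasure.tendsto_integral_of_dominated_convergence (fun x => (A ⊔ 0) * ‖γ x‖)
      (fun n => (SimpleFunc.measurable _).aestronglyMeasurable.mul hγ.aestronglyMeasurable)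
      (hγ.norm.const_mul _)
      (fun n => Eventually.of_forall fun x => ?_)
      (Eventually.of_forall fun x => (hlim x).mul_const _)
    rw [norm_mul]
    gcongr
    exact hA0 n x
  simp_rw [hsimple] at t1
  exact tendsto_nhds_unique t1 t2

lemma IsDensity.cintegral_eq {ν ν' : ComplexMeasure E} {γ φ : E → ℂ} (h : IsDensity ν ν' γ)
    (hφ : Measurable φ) {A : ℝ} (hA : ∀ x, ‖φ x‖ ≤ A) :
    cintegral ν' φ = cintegral ν (fun x => φ x * γ x) := by
  rw [h.2, cintegral_withDensity ν h.1 hφ hA]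

lemma IsDensity.congr {ν ν' : ComplexMeasure E} {γ δ : E → ℂ} (h : IsDensity ν ν' γ)
    (hδ : δ =ᵐ[VectorMeasure.variation ν] γ) : IsDensity ν ν' δ :=
  ⟨h.1.congr hδ.symm, h.2.trans (VectorMeasure.withDensity_congr hδ.symm)⟩

/-- The measure `(γ - δ) ν` vanishes, and its variation is `|γ - δ| |ν|` because the norm of `ℂ` is
multiplicative. -/
lemma IsDensity.ae_eq {ν ν' : ComplexMeasure E} {γ δ : E → ℂ} (hγ : IsDensity ν ν' γ)
    (hδ : IsDensity ν ν' δ) : γ =ᵐ[VectorMeasure.variation ν] δ := by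
  have hnorm : ∀ x y : ℂ, ‖ContinuousLinearMap.mul ℝ ℂ x y‖₊ = ‖x‖₊ * ‖y‖₊ := by simp
  have hzero : VectorMeasure.withDensity ν (γ - δ) (ContinuousLinearMap.mul ℝ ℂ) = 0 := by
    ext s hs : 1
    have := congrArg (fun μ : ComplexMeasure E => μ s) (hγ.2.symm.trans hδ.2)
    simp only [VectorMeasure.withDensity_apply hγ.1, VectorMeasure.withDensity_apply hδ.1] at this
    rw [VectorMeasure.withDensity_apply (hγ.1.sub hδ.1),
      VectorMeasure.integral_sub hγ.1.restrict hδ.1.restrict, this]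
    simp
  have hvar := VectorMeasure.variation_withDensity (hγ.1.sub hδ.1) hnorm
  rw [hzero, VectorMeasure.variation_zero, VectorMeasure.variation_transpose_eq _ _ hnorm,
    eq_comm, withDensity_eq_zero_iff (hγ.1.sub hδ.1).aestronglyMeasurable.enorm] at hvar
  filter_upwards [hvar] with x hx
  simpa [sub_eq_zero] using hx

/-- All pairings of `μ - μ'` with `C` vanish, so their supremum, the total variation norm, is zero.
-/
lemma IsNormDefining.ext {C : Submodule ℂ (E → ℂ)} (hC : IsNormDefining C)
    (hmeas : ∀ φ ∈ C, Measurable φ) (hbdd : ∀ φ ∈ C, ∃ A : ℝ, ∀ x, ‖φ x‖ ≤ A)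
    {μ μ' : ComplexMeasure E} (h : ∀ φ ∈ C, cintegral μ φ = cintegral μ' φ) : μ = μ' := by
  have hzero : ∀ φ ∈ C, cintegral (μ - μ') φ = 0 := by
    intro φ hφ
    obtain ⟨A, hA⟩ := hbdd φ hφ
    have := h φ hφ
    unfold cintegral at this ⊢
    rw [VectorMeasure.integral_sub_vectorMeasure (integrable_variation_of_bound (hmeas φ hφ) hA)
      (integrable_variation_of_bound (hmeas φ hφ) hA), this, sub_self]
  have hle : (VectorMeasure.variation (μ - μ') Set.univ).toReal ≤ 0 :=
    (hC (μ - μ')).2 (by rintro r ⟨u, hu, -, rfl⟩; simp [hzero u hu])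
  have h0 : VectorMeasure.variation (μ - μ') Set.univ = 0 := by
    have := le_antisymm hle ENNReal.toReal_nonneg
    exact ((ENNReal.toReal_eq_zero_iff _).1 this).resolve_right (measure_ne_top _ _)
  rw [Measure.measure_univ_eq_zero, VectorMeasure.variation_eq_zero] at h0
  exact sub_eq_zero.1 h0

end ComplexMeasure

/-! ### Traces of nuclear operators computed in orthonormal systems. -/

section Trace

variable {H : Type*} [NormedAddCommGroup H] [InnerProductSpace ℝ H]

/-- Cauchy–Schwarz followed by Bessel's inequality for each factor. -/
lemma Orthonormal.sum_abs_inner_mul_inner_le {ι : Type*} {e : ι → H} (he : Orthonormal ℝ e)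
    (s : Finset ι) (x y : H) : ∑ i ∈ s, |inner ℝ x (e i) * inner ℝ (e i) y| ≤ ‖x‖ * ‖y‖ := by
  have hx := he.sum_inner_products_le (s := s) x
  have hy := he.sum_inner_products_le (s := s) y
  calc ∑ i ∈ s, |inner ℝ x (e i) * inner ℝ (e i) y|
      = ∑ i ∈ s, ‖inner ℝ (e i) x‖ * ‖inner ℝ (e i) y‖ := by
        simp [abs_mul, real_inner_comm]
    _ ≤ √(∑ i ∈ s, ‖inner ℝ (e i) x‖ ^ 2) * √(∑ i ∈ s, ‖inner ℝ (e i) y‖ ^ 2) :=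
        Real.sum_mul_le_sqrt_mul_sqrt _ _ _
    _ ≤ √(‖x‖ ^ 2) * √(‖y‖ ^ 2) := by gcongr
    _ = ‖x‖ * ‖y‖ := by simp

/-- Parseval for each `n`, then an exchange of the two sums, justified by the absolute bound `‖u n‖
* ‖w n‖` on each row. This is what makes the trace independent of the basis. -/
lemma HilbertBasis.hasSum_tsum_inner_mul_inner {ι : Type*} (e : HilbertBasis ι ℝ H)
    {u w : ℕ → H} (h : Summable fun n => ‖u n‖ * ‖w n‖) :
    HasSum (fun i => ∑' n, inner ℝ (u n) (e i) * inner ℝ (e i) (w n))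
      (∑' n, inner ℝ (u n) (w n)) := by
  have hs : Summable fun p : ℕ × ι => inner ℝ (u p.1) (e p.2) * inner ℝ (e p.2) (w p.1) := by
    refine Summable.of_abs ?_
    rw [summable_prod_of_nonneg (fun p => abs_nonneg _)]
    have hfib : ∀ n, Summable fun i => |inner ℝ (u n) (e i) * inner ℝ (e i) (w n)| := fun n =>
      (e.summable_inner_mul_inner (u n) (w n)).abs
    refine ⟨hfib, h.of_nonneg_of_le (fun n => tsum_nonneg fun i => abs_nonneg _) fun n => ?_⟩
    exact (hfib n).tsum_le_of_sum_le fun s => e.orthonormal.sum_abs_inner_mul_inner_le s _ _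
  have hswap : Summable fun p : ι × ℕ => inner ℝ (u p.2) (e p.1) * inner ℝ (e p.1) (w p.2) :=
    hs.prod_symm
  have heq : ∑' n, inner ℝ (u n) (w n) =
      ∑' i, ∑' n, inner ℝ (u n) (e i) * inner ℝ (e i) (w n) := by
    rw [Summable.tsum_comm (f := fun n i => inner ℝ (u n) (e i) * inner ℝ (e i) (w n)) hs]
    exact tsum_congr fun n => (e.tsum_inner_mul_inner _ _).symm
  rw [heq]
  exact hswap.prod.hasSum

lemma summable_norm_mul_norm {G : Type*} [NormedAddCommGroup G] {a b : ℕ → G}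
    (h : ∑' n, ‖a n‖ₑ * ‖b n‖ₑ ≠ ∞) :
    Summable fun n => ‖a n‖ * ‖b n‖ := by
  have := ENNReal.summable_toReal h
  simpa using this

/-- The sum of the diagonal entries of a trace class operator, in a Hilbert basis of a closed
subspace containing its range. -/
lemma hasSum_hilbertTrace [CompleteSpace H] {T : H →L[ℝ] H} (hT : traceNorm T ≠ ∞)
    (K : Submodule ℝ H) [CompleteSpace K] (hK : ∀ x, T x ∈ K) {ι : Type*}
    (e : HilbertBasis ι ℝ K) :
    HasSum (fun i => inner ℝ (e i : H) (T (e i))) (hilbertTrace T) := by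
  have hlt : traceNorm T < ∞ := lt_top_iff_ne_top.2 hT
  simp only [traceNorm, iInf_lt_iff] at hlt
  obtain ⟨a, b, hab, hfin⟩ := hlt
  have hsum := summable_norm_mul_norm hfin.ne
  let P := K.orthogonalProjectionOnto
  have hdiag : ∀ z y : H, HasSum (fun n => inner ℝ (a n) z * inner ℝ y (b n))
      (inner ℝ y (T z)) := by
    intro z y
    simpa [inner_smul_right] using (hab z).mapL (innerSL ℝ y)
  have hPb : Summable fun n => ‖a n‖ * ‖((P (b n) : K) : H)‖ :=
    hsum.of_nonneg_of_le (fun n => by positivity) fun n => by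
      gcongr
      exact K.norm_orthogonalProjectionOnto_apply_le _
  have hPP : Summable fun n => ‖P (a n)‖ * ‖P (b n)‖ :=
    hsum.of_nonneg_of_le (fun n => by positivity) fun n => by
      gcongr <;> exact K.norm_orthogonalProjectionOnto_apply_le _
  -- The vectors `b n` need not lie in `K`, but `T` maps into `K`, so `P` may be inserted in each
  -- diagonal entry. Both traces then equal `∑ ⟨a n, P (b n)⟩`.
  have hH : hilbertTrace T = ∑' n, inner ℝ (a n) ((P (b n) : K) : H) := by
    obtain ⟨f, hf⟩ := (exists_hilbertBasis ℝ H).choose_spec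
    have key := (f.hasSum_tsum_inner_mul_inner hPb).tsum_eq
    rw [← key, hilbertTrace]
    refine tsum_congr fun i => ?_
    rw [hf]
    have h1 : inner ℝ (i : H) (T i) = inner ℝ ((P (i : H) : K) : H) (T i) := by
      have h2 : ((P (T (i : H)) : K) : H) = T i := Submodule.starProjection_eq_self_iff.2 (hK _)
      rw [← h2]
      simp [P, K.inner_starProjection_left_eq_right, K.starProjection_eq_self_iff.2 (hK _)]
    rw [h1, ← (hdiag i _).tsum_eq]
    refine tsum_congr fun n => ?_
    simp [P, K.inner_starProjection_left_eq_right]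
  have hKsum := e.hasSum_tsum_inner_mul_inner hPP
  have heq : ∑' n, inner ℝ (P (a n)) (P (b n)) = hilbertTrace T := by
    rw [hH]
    refine tsum_congr fun n => ?_
    simp [P, K.inner_starProjection_left_eq_right]
  rw [heq] at hKsum
  refine hKsum.congr_fun fun i => ?_
  rw [← (hdiag (e i) (e i)).tsum_eq]
  refine tsum_congr fun n => ?_
  simp [P]

/-- Each term of any representation of `T` contributes at most `‖a n‖ * ‖b n‖`, whatever `s` is;
this uniformity supplies the dominating function for the partial traces. -/
lemma enorm_sum_inner_le_traceNorm (T : H →L[ℝ] H) {ι : Type*} {e : ι → H}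
    (he : Orthonormal ℝ e) (s : Finset ι) : ‖∑ i ∈ s, inner ℝ (e i) (T (e i))‖ₑ ≤ traceNorm T := by
  refine le_iInf₂ fun a b => le_iInf fun hab => ?_
  by_cases hfin : ∑' n, ‖a n‖ₑ * ‖b n‖ₑ = ∞
  · simp [hfin]
  have hsum := summable_norm_mul_norm hfin
  have hdiag : HasSum (fun n => ∑ i ∈ s, inner ℝ (a n) (e i) * inner ℝ (e i) (b n))
      (∑ i ∈ s, inner ℝ (e i) (T (e i))) := by
    refine hasSum_sum fun i _ => ?_
    simpa [inner_smul_right] using (hab (e i)).mapL (innerSL ℝ (e i))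
  rw [← hdiag.tsum_eq]
  refine enorm_tsum_le_tsum_enorm.trans (ENNReal.tsum_le_tsum fun n => ?_)
  rw [← ofReal_norm, ← ofReal_norm (a n), ← ofReal_norm (b n),
    ← ENNReal.ofReal_mul (norm_nonneg _)]
  exact ENNReal.ofReal_le_ofReal
    ((Finset.abs_sum_le_sum_abs _ _).trans (he.sum_abs_inner_mul_inner_le s _ _))

end Trace

/-! ### Differentiation of transported measures. -/

section SmoothAlong

variable {E H : Type*} [AddCommGroup E] [Module ℝ E] [TopologicalSpace E]
    [NormedAddCommGroup H] [InnerProductSpace ℝ H]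

/-- `φ'` is the derivative of `φ` along `H`; both are bounded, and `φ` and the directional
derivatives of `φ` along `H` are continuous. -/
structure HasBoundedDerivAlong (ι : H →L[ℝ] E) (φ : E → ℂ) (φ' : E → H →L[ℝ] ℂ) : Prop where
  continuous : Continuous φ
  bounded : ∃ A, ∀ x, ‖φ x‖ ≤ A
  hasLineDerivAt : ∀ x k, HasLineDerivAt ℝ φ (φ' x k) x (ι k)
  continuous_deriv : ∀ k, Continuous fun x => φ' x k
  bounded_deriv : ∃ B, ∀ x, ‖φ' x‖ ≤ B

lemma IsBoundedHSmooth.exists_hasBoundedDerivAlong {ι : H →L[ℝ] E} {φ : E → ℂ}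
    (hφ : IsBoundedHSmooth ι φ) : ∃ φ', HasBoundedDerivAlong ι φ φ' := by
  obtain ⟨D, hD, hb⟩ := hφ
  have happ : ∀ x k, continuousMultilinearCurryFin1 ℝ H ℂ (D 1 x) k =
      D 1 x (Fin.cons k Fin.elim0) := by
    intro x k
    rw [continuousMultilinearCurryFin1_apply]
    congr 1
    ext i
    fin_cases i
    rfl
  refine ⟨fun x => continuousMultilinearCurryFin1 ℝ H ℂ (D 1 x), ?_, ?_, ?_, ?_, ?_⟩
  · refine continuous_iff_continuousAt.2 fun x => ?_
    -- A product over `Fin 0` is the one-point space whatever the compact set, so even `∅` serves.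
    have := (hD.cont 0 x ∅ isCompact_empty).tendsto_at (x := Fin.elim0) (by simp)
    simp only [hD.zero] at this
    exact this
  · obtain ⟨A, hA⟩ := hb 0
    refine ⟨A, fun x => ?_⟩
    rw [← hD.zero]
    simpa using (D 0 x).le_of_opNorm_le (hA x) Fin.elim0
  · intro x k
    rw [hasLineDerivAt_iff_tendsto_slope_zero, happ]
    have := (hD.deriv 0 x k ∅ isCompact_empty).tendsto_at (x := Fin.elim0) (by simp)
    simpa only [hD.zero] using this
  · intro k
    refine continuous_iff_continuousAt.2 fun x => ?_
    simp only [happ]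
    exact (hD.cont 1 x {k} isCompact_singleton).tendsto_at
      (x := Fin.cons k Fin.elim0) (by simp)
  · obtain ⟨B, hB⟩ := hb 1
    exact ⟨B, fun x => by simpa using hB x⟩

lemma HasLineDerivAt.comp_sub_smul {φ : E → ℂ} {φ' : E → H →L[ℝ] ℂ} {ι : H →L[ℝ] E}
    (h : ∀ x k, HasLineDerivAt ℝ φ (φ' x k) x (ι k)) (x : E) (k : H) (t : ℝ) :
    HasDerivAt (fun t : ℝ => φ (x - t • ι k)) (-(φ' (x - t • ι k) k)) t := by
  have h1 : HasDerivAt (fun r : ℝ => φ (x - t • ι k + r • ι k)) (φ' (x - t • ι k) k) (t - t) := by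
    simpa [HasLineDerivAt] using h (x - t • ι k) k
  have h2 : HasDerivAt (fun s : ℝ => t - s) (-1) t := by
    simpa using (hasDerivAt_id t).const_sub t
  have := HasDerivAt.scomp t h1 h2
  simpa [Function.comp_def, sub_smul] using this

/-- Mean value inequality on the segment; it dominates the difference quotients uniformly in `t`. -/
lemma norm_comp_sub_smul_sub_le {φ : E → ℂ} {φ' : E → H →L[ℝ] ℂ} {ι : H →L[ℝ] E}
    (h : ∀ x k, HasLineDerivAt ℝ φ (φ' x k) x (ι k)) {B : ℝ} (hB : ∀ x, ‖φ' x‖ ≤ B)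
    (x : E) (k : H) (t : ℝ) : ‖φ (x - t • ι k) - φ x‖ ≤ B * ‖k‖ * |t| := by
  have := Convex.norm_image_sub_le_of_norm_hasDerivWithin_le (𝕜 := ℝ) (s := Set.univ) (x := 0)
    (y := t) (C := B * ‖k‖)
    (fun s _ => (HasLineDerivAt.comp_sub_smul h x k s).hasDerivWithinAt)
    (fun s _ => by rw [norm_neg]; exact (φ' _).le_of_opNorm_le (hB _) k)
    convex_univ (Set.mem_univ _) (Set.mem_univ _)
  simpa using this

variable [IsTopologicalAddGroup E] [ContinuousSMul ℝ E] [MeasurableSpace E] [BorelSpace E]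

/-- Translations along a strongly measurable vector field with values in a Hilbert subspace are
Borel, although the addition of `E` need not be measurable. -/
lemma measurable_sub_smul (ι : H →L[ℝ] E) {v : E → H} (hv : StronglyMeasurable v) (t : ℝ) :
    Measurable fun x => x - t • ι (v x) := by
  borelize H
  -- Second countability of the range of `v` makes the Borel σ-algebra of the product with `E` the
  -- product σ-algebra, so a continuous map of the pair is measurable.
  have := hv.isSeparable_range.secondCountableTopology
  have hc : Continuous fun p : E × Set.range v => p.1 - t • ι p.2 := by fun_prop
  have hm : Measurable fun x => (x, (⟨v x, x, rfl⟩ : Set.range v)) :=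
    measurable_id.prodMk (hv.measurable.subtype_mk)
  exact hc.measurable.comp hm

/-- Moving the transport onto `φ` leaves difference quotients of `φ (x - t • ι (v x))`, dominated by
`B * ‖v x‖`. This links the `τ_C` and `C` notions. -/
lemma hasDerivAt_cintegral_map (ν : ComplexMeasure E) {ι : H →L[ℝ] E} {φ : E → ℂ}
    {φ' : E → H →L[ℝ] ℂ} (hφ : HasBoundedDerivAlong ι φ φ') {v : E → H}
    (hv : StronglyMeasurable v)
    (hint : Integrable (fun x => ‖v x‖) (VectorMeasure.variation ν)) :
    HasDerivAt (fun t : ℝ => cintegral (VectorMeasure.map ν (fun x => x - t • ι (v x))) φ)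
      (-cintegral ν (fun x => φ' x (v x))) 0 := by
  obtain ⟨A, hA⟩ := hφ.bounded
  obtain ⟨B, hB⟩ := hφ.bounded_deriv
  have hS := measurable_sub_smul ι hv
  have hm := hφ.continuous.measurable
  have hcomp : ∀ t : ℝ, VectorMeasure.Integrable ν (fun x => φ (x - t • ι (v x))) := fun t =>
    integrable_variation_of_bound (hm.comp (hS t)) fun x => hA _
  have hmap : ∀ t : ℝ, cintegral (VectorMeasure.map ν (fun x => x - t • ι (v x))) φ =
      cintegral ν (fun x => φ (x - t • ι (v x))) := fun t =>
    VectorMeasure.integral_map (hS t) hm.aestronglyMeasurable (hcomp t)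
  simp_rw [hmap]
  rw [hasDerivAt_iff_tendsto_slope_zero, ← cintegral_neg]
  have hq : ∀ t : ℝ, t⁻¹ • (cintegral ν (fun x => φ (x - (0 + t) • ι (v x))) -
      cintegral ν (fun x => φ (x - (0 : ℝ) • ι (v x)))) =
      cintegral ν (fun x => t⁻¹ • (φ (x - t • ι (v x)) - φ x)) := by
    intro t
    unfold cintegral
    rw [VectorMeasure.integral_fun_smul, zero_add, ← VectorMeasure.integral_fun_sub (hcomp t)]
    · simp
    · exact hcomp 0
  simp_rw [hq]
  refine VectorMeasure.tendsto_integral_filter_of_dominated_convergence (fun x => B * ‖v x‖)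
    (Eventually.of_forall fun t => ?_) ?_ (hint.const_mul B) (Eventually.of_forall fun x => ?_)
  · exact (((hm.comp (hS t)).sub hm).const_smul t⁻¹).aestronglyMeasurable
  · filter_upwards [self_mem_nhdsWithin] with t ht
    refine Eventually.of_forall fun x => ?_
    rw [norm_smul, norm_inv, Real.norm_eq_abs, inv_mul_le_iff₀ (abs_pos.2 ht)]
    exact (norm_comp_sub_smul_sub_le hφ.hasLineDerivAt hB x (v x) t).trans_eq (by ring)
  · have := (HasLineDerivAt.comp_sub_smul hφ.hasLineDerivAt x (v x) 0).tendsto_slope_zero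
    simpa using this

lemma IsTauLogDerivAlong.cintegral_lineDeriv {C : Submodule ℂ (E → ℂ)} {ν : ComplexMeasure E}
    {ι : H →L[ℝ] E} {v : E → H} {γ : E → ℂ}
    (h : IsTauLogDerivAlong C ν (fun x => ι (v x)) γ) (hv : StronglyMeasurable v)
    (hint : Integrable (fun x => ‖v x‖) (VectorMeasure.variation ν)) {φ : E → ℂ} (hφC : φ ∈ C)
    {φ' : E → H →L[ℝ] ℂ} (hφ : HasBoundedDerivAlong ι φ φ') :
    cintegral ν (fun x => φ' x (v x)) = -cintegral ν (fun x => φ x * γ x) := by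
  obtain ⟨-, -, ν', hder, hdens⟩ := h
  obtain ⟨A, hA⟩ := hφ.bounded
  rw [← hdens.cintegral_eq hφ.continuous.measurable hA,
    ← (hasDerivAt_cintegral_map ν hφ hv hint).unique (hder φ hφC), neg_neg]

end SmoothAlong

/-! ### Orthonormal systems in separable spaces and partial expansions. -/

section HilbertBasis

variable {H : Type*} [NormedAddCommGroup H] [InnerProductSpace ℝ H]

/-- The distance is `√2`; the bound `1` suffices for balls of radius `1 / 2` to be disjoint, whence
countability. -/
lemma Orthonormal.one_le_dist {ι : Type*} {e : ι → H} (he : Orthonormal ℝ e) {i j : ι}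
    (hij : i ≠ j) : 1 ≤ dist (e i) (e j) := by
  have h : ‖e i - e j‖ ^ 2 = 2 := by
    rw [norm_sub_sq_real, he.1 i, he.1 j, he.2 hij]
    norm_num
  rw [dist_eq_norm]
  nlinarith [norm_nonneg (e i - e j)]

lemma Orthonormal.countable [TopologicalSpace.SeparableSpace H] {ι : Type*} {e : ι → H}
    (he : Orthonormal ℝ e) : Countable ι := by
  refine Pairwise.countable_of_isOpen_disjoint (s := fun i => Metric.ball (e i) (1 / 2)) ?_
    (fun _ => Metric.isOpen_ball) fun i => ⟨e i, Metric.mem_ball_self (by norm_num)⟩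
  intro i j hij
  refine Metric.ball_disjoint_ball ?_
  have := he.one_le_dist hij
  linarith

lemma Orthonormal.norm_sum_inner_smul_le {ι : Type*} {e : ι → H} (he : Orthonormal ℝ e)
    (s : Finset ι) (x : H) : ‖∑ i ∈ s, inner ℝ (e i) x • e i‖ ≤ ‖x‖ := by
  refine le_of_sq_le_sq ?_ (norm_nonneg x)
  rw [← real_inner_self_eq_norm_sq, he.inner_sum]
  refine le_trans (le_of_eq ?_) (he.sum_inner_products_le (s := s) x)
  exact Finset.sum_congr rfl fun i _ => by simp [sq]

lemma HilbertBasis.hasSum_inner_smul_of_mem {ι : Type*} {K : Submodule ℝ H} [CompleteSpace K]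
    (e : HilbertBasis ι ℝ K) {x : H} (hx : x ∈ K) :
    HasSum (fun i => inner ℝ (e i : H) x • (e i : H)) x := by
  simpa [e.repr_apply_apply] using (e.hasSum_repr ⟨x, hx⟩).mapL K.subtypeL

end HilbertBasis

/-! ### Integration by parts along `h`. -/

section VectorField

variable {E H : Type*} [AddCommGroup E] [Module ℝ E] [NormedAddCommGroup H]
  [InnerProductSpace ℝ H] {h : E → H} {h' : E → H →L[ℝ] H}

/-- Difference quotients of `h` lie in the span. Hence `h' x` maps into `K` and its trace can be
taken in a basis of `K`. -/
lemma HasLineDerivAt.mem_topologicalClosure_span_range {x v : E} {k : H}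
    (hd : HasLineDerivAt ℝ h k x v) : k ∈ (Submodule.span ℝ (Set.range h)).topologicalClosure := by
  refine mem_closure_of_tendsto hd.tendsto_slope_zero (Eventually.of_forall fun t => ?_)
  exact Submodule.smul_mem _ _ (Submodule.sub_mem _ (Submodule.subset_span ⟨_, rfl⟩)
    (Submodule.subset_span ⟨_, rfl⟩))

lemma HasLineDerivAt.mul_inner {φ : E → ℂ} {a : ℂ} {x v : E} {b : H}
    (hφ : HasLineDerivAt ℝ φ a x v) (hh : HasLineDerivAt ℝ h b x v) (k : H) :
    HasLineDerivAt ℝ (fun x => φ x * ((inner ℝ k (h x) : ℝ) : ℂ))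
      (a * ((inner ℝ k (h x) : ℝ) : ℂ) + φ x * ((inner ℝ k b : ℝ) : ℂ)) x v := by
  have h1 : HasDerivAt (fun t : ℝ => ((inner ℝ k (h (x + t • v)) : ℝ) : ℂ))
      ((inner ℝ k b : ℝ) : ℂ) 0 :=
    ((innerSL ℝ k).hasFDerivAt.comp_hasDerivAt (0 : ℝ) hh).ofReal_comp
  have h2 := HasDerivAt.mul hφ h1
  simp only [zero_smul, add_zero] at h2
  exact h2

variable [TopologicalSpace E] [IsTopologicalAddGroup E] [MeasurableSpace E] [BorelSpace E]
  {ι : H →L[ℝ] E}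

lemma stronglyMeasurable_of_hasLineDerivAt (hmeas : StronglyMeasurable h)
    (hderiv : ∀ x k, HasLineDerivAt ℝ h (h' x k) x (ι k)) (k : H) :
    StronglyMeasurable fun x => h' x k := by
  refine stronglyMeasurable_of_tendsto (𝓝[≠] (0 : ℝ))
    (f := fun (t : ℝ) x => t⁻¹ • (h (x + t • ι k) - h x)) (fun t => ?_)
    (tendsto_pi_nhds.2 fun x => (hderiv x k).tendsto_slope_zero)
  have : Measurable fun x : E => x + t • ι k := (continuous_id.add continuous_const).measurable
  exact ((hmeas.comp_measurable this).sub hmeas).const_smul t⁻¹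

variable [ContinuousSMul ℝ E] {C : Submodule ℂ (E → ℂ)} {ν : ComplexMeasure E} {β : E → H →ₗ[ℝ] ℂ}

/-- The first two terms are the derivative along `k` of `φ ⟨k, h⟩`, which is in `C`; the identity is
integration by parts for the constant field `k`. -/
lemma cintegral_lineDeriv_component (hC : ∀ φ ∈ C, IsBoundedHSmooth ι φ)
    (hβ : IsTauLogDerivOver ι C ν β)
    (hderiv : ∀ x k, HasLineDerivAt ℝ h (h' x k) x (ι k))
    (hmul : ∀ φ ∈ C, ∀ k : H, (fun x => φ x * ((inner ℝ k (h x) : ℝ) : ℂ)) ∈ C)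
    {φ : E → ℂ} (hφC : φ ∈ C) {φ' : E → H →L[ℝ] ℂ} (hφ : HasBoundedDerivAlong ι φ φ') (k : H) :
    VectorMeasure.Integrable ν (fun x => φ' x k * ((inner ℝ k (h x) : ℝ) : ℂ) +
      φ x * ((inner ℝ k (h' x k) : ℝ) : ℂ) + φ x * (((inner ℝ k (h x) : ℝ) : ℂ) * β x k)) ∧
    cintegral ν (fun x => φ' x k * ((inner ℝ k (h x) : ℝ) : ℂ) +
      φ x * ((inner ℝ k (h' x k) : ℝ) : ℂ) + φ x * (((inner ℝ k (h x) : ℝ) : ℂ) * β x k)) = 0 := by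
  obtain ⟨ψ', hψ⟩ := (hC _ (hmul φ hφC k)).exists_hasBoundedDerivAlong
  have heq : ∀ x, φ' x k * ((inner ℝ k (h x) : ℝ) : ℂ) + φ x * ((inner ℝ k (h' x k) : ℝ) : ℂ) =
      ψ' x k := fun x =>
    ((hφ.hasLineDerivAt x k).mul_inner (hderiv x k) k).unique (hψ.hasLineDerivAt x k)
  have hparts := IsTauLogDerivAlong.cintegral_lineDeriv (ι := ι) (v := fun _ => k) (hβ k)
    stronglyMeasurable_const (integrable_const _) (hmul φ hφC k) hψ
  simp only [heq, ← mul_assoc]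
  obtain ⟨A, hA⟩ := hψ.bounded
  obtain ⟨B, hB⟩ := hψ.bounded_deriv
  obtain ⟨-, -, ν', -, hdens⟩ := hβ k
  have h1 : VectorMeasure.Integrable ν fun x => ψ' x k :=
    integrable_variation_of_bound (hψ.continuous_deriv k).measurable
      fun x => (ψ' x).le_of_opNorm_le (hB x) k
  have h2 : VectorMeasure.Integrable ν fun x => φ x * ((inner ℝ k (h x) : ℝ) : ℂ) * β x k :=
    hdens.1.bdd_mul hψ.continuous.measurable.aestronglyMeasurable (Eventually.of_forall hA)
  refine ⟨h1.add h2, ?_⟩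
  rw [cintegral_add _ h1 h2, hparts, neg_add_cancel]

variable [CompleteSpace H]

/-- Integration by parts along a vector field with values in a Hilbert subspace. -/
theorem cintegral_lineDeriv_vectorField (hC : ∀ φ ∈ C, IsBoundedHSmooth ι φ)
    (hβ : IsTauLogDerivOver ι C ν β) (hmeas : StronglyMeasurable h)
    (hderiv : ∀ x k, HasLineDerivAt ℝ h (h' x k) x (ι k))
    (hmul : ∀ φ ∈ C, ∀ k : H, (fun x => φ x * ((inner ℝ k (h x) : ℝ) : ℂ)) ∈ C)
    (hint : Integrable (fun x => ‖h x‖) (VectorMeasure.variation ν)) {N : E → ℝ}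
    (hN : ∀ᵐ x ∂(VectorMeasure.variation ν),
      ∀ k ∈ (Submodule.span ℝ (Set.range h)).topologicalClosure, ‖β x k‖ ≤ N x * ‖k‖)
    (hNint : Integrable (fun x => N x * ‖h x‖) (VectorMeasure.variation ν)) {M : E → ℝ}
    (hM : ∀ᵐ x ∂(VectorMeasure.variation ν), traceNorm (h' x) ≤ ENNReal.ofReal (M x))
    (hMint : Integrable M (VectorMeasure.variation ν)) :
    VectorMeasure.Integrable ν (fun x => β x (h x) + ((hilbertTrace (h' x) : ℝ) : ℂ)) ∧
    ∀ φ ∈ C, ∀ φ' : E → H →L[ℝ] ℂ, HasBoundedDerivAlong ι φ φ' →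
      VectorMeasure.Integrable ν (fun x => φ' x (h x)) ∧
      cintegral ν (fun x => φ' x (h x)) =
        -cintegral ν (fun x => φ x * (β x (h x) + ((hilbertTrace (h' x) : ℝ) : ℂ))) := by
  set K := (Submodule.span ℝ (Set.range h)).topologicalClosure with hK
  have : CompleteSpace K :=
    (Submodule.isClosed_topologicalClosure _).completeSpace_coe
  have hsep : TopologicalSpace.IsSeparable (K : Set H) := hmeas.isSeparable_range.span.closure
  have : TopologicalSpace.SeparableSpace K := hsep.separableSpace
  obtain ⟨w, e, -⟩ := exists_hilbertBasis ℝ K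
  -- Countability makes `atTop` on `Finset w` countably generated, as measurability of limits and
  -- dominated convergence require.
  have : Countable w := e.orthonormal.countable
  have he : Orthonormal ℝ fun i => (e i : H) :=
    e.orthonormal.comp_linearIsometry K.subtypeₗᵢ
  have hhK : ∀ x, h x ∈ K := fun x =>
    Submodule.le_topologicalClosure _ (Submodule.subset_span ⟨x, rfl⟩)
  let p : Finset w → E → H := fun s x => ∑ i ∈ s, inner ℝ (e i : H) (h x) • (e i : H)
  have hpK : ∀ s x, p s x ∈ K := fun s x =>
    Submodule.sum_mem _ fun i _ => Submodule.smul_mem _ _ (e i).2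
  have hp : ∀ x, Tendsto (fun s => p s x) atTop (𝓝 (h x)) := fun x =>
    e.hasSum_inner_smul_of_mem (hhK x)
  have hpn : ∀ s x, ‖p s x‖ ≤ ‖h x‖ := fun s x => he.norm_sum_inner_smul_le s (h x)
  have hcoef : ∀ i, StronglyMeasurable fun x => inner ℝ (e i : H) (h x) := fun i =>
    (innerSL ℝ (e i : H)).continuous.comp_stronglyMeasurable hmeas
  have hβp : ∀ s x, β x (p s x) = ∑ i ∈ s, ((inner ℝ (e i : H) (h x) : ℝ) : ℂ) * β x (e i) := by
    intro s x
    simp [p]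
  have hβm : ∀ s, AEStronglyMeasurable (fun x => β x (p s x)) (VectorMeasure.variation ν) := by
    intro s
    simp only [hβp]
    refine Finset.aestronglyMeasurable_fun_sum s fun i _ => ?_
    obtain ⟨-, -, _, -, hdens⟩ := hβ (e i)
    exact (Complex.continuous_ofReal.comp_stronglyMeasurable (hcoef i)).aestronglyMeasurable.mul
      hdens.1.aestronglyMeasurable
  -- `N` has no assumed sign, so the dominating function uses `|N|`.
  have hNabs : ∀ᵐ x ∂(VectorMeasure.variation ν), ∀ k ∈ K, ‖k‖ ≤ ‖h x‖ →
      ‖β x k‖ ≤ ‖N x * ‖h x‖‖ := by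
    filter_upwards [hN] with x hx k hk hkn
    calc ‖β x k‖ ≤ N x * ‖k‖ := hx k hk
      _ ≤ |N x| * ‖h x‖ := by gcongr; exact le_abs_self _
      _ = ‖N x * ‖h x‖‖ := by simp
  -- `β x` is merely linear on `H`; the bound by `N x` makes it continuous on `K`, which contains `p
  -- s x` and `h x`.
  have hβlim : ∀ᵐ x ∂(VectorMeasure.variation ν),
      Tendsto (fun s => β x (p s x)) atTop (𝓝 (β x (h x))) := by
    filter_upwards [hN] with x hx
    rw [tendsto_iff_norm_sub_tendsto_zero]
    have h0 : Tendsto (fun s => N x * ‖p s x - h x‖) atTop (𝓝 0) := by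
      simpa using (tendsto_iff_norm_sub_tendsto_zero.1 (hp x)).const_mul (N x)
    refine squeeze_zero (fun _ => norm_nonneg _) (fun s => ?_) h0
    rw [← map_sub]
    exact hx _ (sub_mem (hpK s x) (hhK x))
  have hβint : VectorMeasure.Integrable ν fun x => β x (h x) := by
    refine hNint.mono (aestronglyMeasurable_of_tendsto_ae atTop hβm hβlim) ?_
    filter_upwards [hNabs] with x hx
    exact hx _ (hhK x) le_rfl
  let d : Finset w → E → ℂ := fun s x =>
    ((∑ i ∈ s, inner ℝ (e i : H) (h' x (e i)) : ℝ) : ℂ)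
  have hdm : ∀ s, AEStronglyMeasurable (d s) (VectorMeasure.variation ν) := by
    intro s
    refine StronglyMeasurable.aestronglyMeasurable
      (Complex.continuous_ofReal.comp_stronglyMeasurable ?_)
    exact Finset.stronglyMeasurable_fun_sum s fun i _ =>
      (innerSL ℝ (e i : H)).continuous.comp_stronglyMeasurable
        (stronglyMeasurable_of_hasLineDerivAt hmeas hderiv (e i : H))
  have hdM : ∀ᵐ x ∂(VectorMeasure.variation ν), ∀ s, ‖d s x‖ ≤ ‖M x‖ := by
    filter_upwards [hM] with x hx s
    have h1 := (enorm_sum_inner_le_traceNorm (h' x) he s).trans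
      (hx.trans (ENNReal.ofReal_le_ofReal (le_abs_self _)))
    rw [← ofReal_norm, ENNReal.ofReal_le_ofReal_iff (abs_nonneg _)] at h1
    simpa only [d, Complex.norm_real, Real.norm_eq_abs] using h1
  have hdlim : ∀ᵐ x ∂(VectorMeasure.variation ν),
      Tendsto (fun s => d s x) atTop (𝓝 ((hilbertTrace (h' x) : ℝ) : ℂ)) := by
    filter_upwards [hM] with x hx
    exact (Complex.continuous_ofReal.tendsto _).comp
      (hasSum_hilbertTrace (hx.trans_lt ENNReal.ofReal_lt_top).ne K
        (fun k => (hderiv x k).mem_topologicalClosure_span_range) e)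
  have htrint : VectorMeasure.Integrable ν fun x => ((hilbertTrace (h' x) : ℝ) : ℂ) := by
    refine hMint.mono (aestronglyMeasurable_of_tendsto_ae atTop hdm hdlim) ?_
    filter_upwards [hdM, hdlim] with x hx hl
    exact le_of_tendsto hl.norm (Eventually.of_forall hx)
  refine ⟨hβint.add htrint, fun φ hφC φ' hφ => ?_⟩
  obtain ⟨A, hA⟩ := hφ.bounded
  obtain ⟨B, hB⟩ := hφ.bounded_deriv
  have hφm := hφ.continuous.measurable.aestronglyMeasurable (μ := VectorMeasure.variation ν)
  have hφ'p : ∀ s x, φ' x (p s x) =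
      ∑ i ∈ s, φ' x (e i) * ((inner ℝ (e i : H) (h x) : ℝ) : ℂ) := by
    intro s x
    simp [p, mul_comm]
  have hφ'm : ∀ s, AEStronglyMeasurable (fun x => φ' x (p s x)) (VectorMeasure.variation ν) := by
    intro s
    simp only [hφ'p]
    exact Finset.aestronglyMeasurable_fun_sum s fun i _ =>
      (hφ.continuous_deriv (e i)).measurable.aestronglyMeasurable.mul
        (Complex.continuous_ofReal.comp_stronglyMeasurable (hcoef i)).aestronglyMeasurable
  have hφ'lim : ∀ x, Tendsto (fun s => φ' x (p s x)) atTop (𝓝 (φ' x (h x))) := fun x =>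
    ((φ' x).continuous.tendsto _).comp (hp x)
  have hφ'b : ∀ x k, ‖φ' x k‖ ≤ B * ‖k‖ := fun x k => (φ' x).le_of_opNorm_le (hB x) k
  have hφ'int : VectorMeasure.Integrable ν fun x => φ' x (h x) :=
    (hint.const_mul B).mono' (aestronglyMeasurable_of_tendsto_ae atTop hφ'm
      (Eventually.of_forall hφ'lim)) (Eventually.of_forall fun x => hφ'b x _)
  refine ⟨hφ'int, ?_⟩
  -- The component identity is quadratic in `k`, so summing it over `e i` reassembles `p s x` in the
  -- outer terms and the partial trace in the middle one.
  have hsum : ∀ s, cintegral ν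
      (fun x => φ' x (p s x) + φ x * d s x + φ x * β x (p s x)) = 0 := by
    intro s
    have hi := fun i : w => cintegral_lineDeriv_component hC hβ hderiv hmul hφC hφ (e i : H)
    have h1 := VectorMeasure.integral_finsetSum (B := ContinuousLinearMap.mul ℝ ℂ) s
      fun i _ => (hi i).1
    have h2 : ∀ x, φ' x (p s x) + φ x * d s x + φ x * β x (p s x) =
        ∑ i ∈ s, (φ' x (e i) * ((inner ℝ (e i : H) (h x) : ℝ) : ℂ) +
          φ x * ((inner ℝ (e i : H) (h' x (e i)) : ℝ) : ℂ) +
          φ x * (((inner ℝ (e i : H) (h x) : ℝ) : ℂ) * β x (e i))) := by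
      intro x
      simp only [hφ'p, hβp, d, Complex.ofReal_sum, Finset.mul_sum, Finset.sum_add_distrib]
    simp only [h2]
    exact h1.trans (Finset.sum_eq_zero fun i _ => (hi i).2)
  have hlim : Tendsto (fun s => cintegral ν
      (fun x => φ' x (p s x) + φ x * d s x + φ x * β x (p s x))) atTop
      (𝓝 (cintegral ν (fun x => φ' x (h x) + φ x * ((hilbertTrace (h' x) : ℝ) : ℂ) +
        φ x * β x (h x)))) := by
    refine VectorMeasure.tendsto_integral_filter_of_dominated_convergence
      (fun x => |B| * ‖h x‖ + |A| * ‖M x‖ + |A| * ‖N x * ‖h x‖‖)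
      (Eventually.of_forall fun s =>
        ((hφ'm s).add (hφm.mul (hdm s))).add (hφm.mul (hβm s)))
      (Eventually.of_forall fun s => ?_)
      (((hint.const_mul _).add (hMint.norm.const_mul _)).add (hNint.norm.const_mul _)) ?_
    · filter_upwards [hdM, hNabs] with x hx hx'
      have hA' : ‖φ x‖ ≤ |A| := (hA x).trans (le_abs_self A)
      refine norm_add₃_le.trans (add_le_add_three ?_ ?_ ?_)
      · refine (hφ'b x _).trans ?_
        gcongr
        · exact le_abs_self B
        · exact hpn s x
      · rw [norm_mul]
        gcongr
        exact hx s
      · rw [norm_mul]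
        gcongr
        exact hx' _ (hpK s x) (hpn s x)
    · filter_upwards [hdlim, hβlim] with x hx hx'
      exact ((hφ'lim x).add (hx.const_mul _)).add (hx'.const_mul _)
  simp only [hsum] at hlim
  have hzero := tendsto_nhds_unique tendsto_const_nhds hlim
  have hγ : VectorMeasure.Integrable ν
      fun x => φ x * (β x (h x) + ((hilbertTrace (h' x) : ℝ) : ℂ)) :=
    (hβint.add htrint).bdd_mul hφm (Eventually.of_forall hA)
  rw [eq_neg_iff_add_eq_zero, ← cintegral_add _ hφ'int hγ, hzero]
  congr 1
  ext x
  ring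

end VectorField

/-! ### Existence, formula and uniqueness in both senses. -/

theorem theorem1 {E H : Type*} [AddCommGroup E] [Module ℝ E] [TopologicalSpace E]
    [IsTopologicalAddGroup E] [ContinuousSMul ℝ E] [LocallyConvexSpace ℝ E]
    [MeasurableSpace E] [BorelSpace E]
    [NormedAddCommGroup H] [InnerProductSpace ℝ H] [CompleteSpace H]
    (ι : H →L[ℝ] E) (_hι : Function.Injective ι)
    (C : Submodule ℂ (E → ℂ)) (_hC : IsTestSpace ι C)
    (ν : ComplexMeasure E)
    (β : E → H →ₗ[ℝ] ℂ) (_hβ : IsTauLogDerivOver ι C ν β)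
    -- the `H`-valued vector field and its derivative over `H`
    (h : E → H) (_hmeas : StronglyMeasurable h)
    (h' : E → H →L[ℝ] H) (_hderiv : ∀ x k, HasLineDerivAt ℝ h (h' x k) x (ι k))
    -- `C` is stable under multiplication by the components of the vector field
    (_hmul : ∀ φ ∈ C, ∀ k : H, (fun x => φ x * ((inner ℝ k (h x) : ℝ) : ℂ)) ∈ C)
    -- integrability of the vector field, of `β (h x) x` and of the trace norm of `h' x`
    (_hint : Integrable (fun x => ‖h x‖) (VectorMeasure.variation ν))
    (N : E → ℝ)
    (_hN : ∀ᵐ x ∂(VectorMeasure.variation ν),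
      ∀ k ∈ (Submodule.span ℝ (Set.range h)).topologicalClosure, ‖β x k‖ ≤ N x * ‖k‖)
    (_hNint : Integrable (fun x => N x * ‖h x‖) (VectorMeasure.variation ν))
    (M : E → ℝ)
    (_hM : ∀ᵐ x ∂(VectorMeasure.variation ν), traceNorm (h' x) ≤ ENNReal.ofReal (M x))
    (_hMint : Integrable M (VectorMeasure.variation ν)) :
    -- the logarithmic derivative along `h`, in either sense, exists, equals
    -- `β (h x) x + tr h' x`, and is unique up to null sets
    (∀ γ : E → ℂ, IsCLogDerivAlong C ν (fun x => ι (h x)) γ ↔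
      γ =ᵐ[VectorMeasure.variation ν] fun x => β x (h x) + ((hilbertTrace (h' x) : ℝ) : ℂ)) ∧
    (∀ γ : E → ℂ, IsTauLogDerivAlong C ν (fun x => ι (h x)) γ ↔
      γ =ᵐ[VectorMeasure.variation ν] fun x => β x (h x) + ((hilbertTrace (h' x) : ℝ) : ℂ)) := by
  obtain ⟨hγ₀, hparts⟩ := cintegral_lineDeriv_vectorField _hC.smooth _hβ _hmeas _hderiv _hmul
    _hint _hN _hNint _hM _hMint
  set γ₀ : E → ℂ := fun x => β x (h x) + ((hilbertTrace (h' x) : ℝ) : ℂ)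
  have hdens : IsDensity ν (VectorMeasure.withDensity ν γ₀ (ContinuousLinearMap.mul ℝ ℂ)) γ₀ :=
    ⟨hγ₀, rfl⟩
  set ν₀ := VectorMeasure.withDensity ν γ₀ (ContinuousLinearMap.mul ℝ ℂ)
  have hbd : ∀ φ ∈ C, ∃ φ', HasBoundedDerivAlong ι φ φ' := fun φ hφ =>
    (_hC.smooth φ hφ).exists_hasBoundedDerivAlong
  have hν₀ : ∀ φ ∈ C, ∀ φ' : E → H →L[ℝ] ℂ, HasBoundedDerivAlong ι φ φ' →
      cintegral ν (fun x => φ' x (h x)) = -cintegral ν₀ φ := by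
    intro φ hφC φ' hφ
    obtain ⟨A, hA⟩ := hφ.bounded
    rw [(hparts φ hφC φ' hφ).2, hdens.cintegral_eq hφ.continuous.measurable hA]
  -- Either definition forces its derivative measure to pair with `C` as `ν₀` does, so both
  -- uniqueness claims reduce to this.
  have huniq : ∀ (ν' : ComplexMeasure E) (γ : E → ℂ), IsDensity ν ν' γ →
      (∀ φ ∈ C, cintegral ν' φ = cintegral ν₀ φ) → γ =ᵐ[VectorMeasure.variation ν] γ₀ := by
    intro ν' γ hγ hν'
    have : ν' = ν₀ := _hC.normDefining.ext
      (fun φ hφ => let ⟨_, hφ'⟩ := hbd φ hφ; hφ'.continuous.measurable)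
      (fun φ hφ => let ⟨_, hφ'⟩ := hbd φ hφ; hφ'.bounded) hν'
    exact (this ▸ hγ).ae_eq hdens
  have hline : ∀ {φ : E → ℂ} {φ' : E → H →L[ℝ] ℂ}, HasBoundedDerivAlong ι φ φ' →
      (fun x => lineDeriv ℝ φ x (ι (h x))) = fun x => φ' x (h x) := fun hφ =>
    funext fun x => (hφ.hasLineDerivAt x (h x)).lineDeriv
  refine ⟨fun γ => ⟨?_, fun hγ => ⟨ν₀, fun φ hφC => ?_, hdens.congr hγ⟩⟩,
    fun γ => ⟨?_, fun hγ => ⟨?_, ?_, ν₀, fun φ hφC => ?_, hdens.congr hγ⟩⟩⟩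
  · rintro ⟨ν', hν', hγ⟩
    refine huniq ν' γ hγ fun φ hφC => ?_
    obtain ⟨φ', hφ⟩ := hbd φ hφC
    have := (hν' φ hφC).2.2
    rw [hline hφ, hν₀ φ hφC φ' hφ] at this
    exact (neg_injective this).symm
  · obtain ⟨φ', hφ⟩ := hbd φ hφC
    rw [hline hφ]
    exact ⟨fun x => (hφ.hasLineDerivAt x (h x)).lineDifferentiableAt, (hparts φ hφC φ' hφ).1,
      hν₀ φ hφC φ' hφ⟩
  · rintro ⟨-, -, ν', hν', hγ⟩
    refine huniq ν' γ hγ fun φ hφC => ?_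
    obtain ⟨φ', hφ⟩ := hbd φ hφC
    rw [(hν' φ hφC).unique (hasDerivAt_cintegral_map ν hφ _hmeas _hint),
      hν₀ φ hφC φ' hφ, neg_neg]
  · ext x
    simp
  · exact Eventually.of_forall fun t => measurable_sub_smul ι _hmeas t
  · obtain ⟨φ', hφ⟩ := hbd φ hφC
    have := hasDerivAt_cintegral_map ν hφ _hmeas _hint
    rwa [hν₀ φ hφC φ' hφ, neg_neg] at this
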